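/- Let $r\ge 0$ and $n\ge 1$ be integers and label the tensor factors of $(\mathbb C^n)^{\otimes 2r}$ by $[1,T],\dots,[r,T],[1,B],\dots,[r,B]$. A partial permutation $\beta$ of $\{1,\dots,r\}$ is an injective map $\beta:\mathrm{dom}(\beta)\to\{1,\dots,r\}$ with $\mathrm{dom}(\beta)\subseteq\{1,\dots,r\}$. Let $\tilde T_\beta^{(n)}$ be the operator on $(\mathbb C^n)^{\otimes 2r}$ that acts as the normalized Bell projector $\frac1n\sum_{i,j=1}^n e_ie_j^*\otimes e_ie_j^*$ on the pair of factors $[x,T],[\beta(x),B]$ for every $x\in\mathrm{dom}(\beta)$, and as the identity on all remaining factors. Let $\psi_n$ be a uniformly distributed unit vector of $(\mathbb C^n)^{\otimes 2r}$, and write $f_n=\langle\psi_n|\tilde T_\beta^{(n)}|\psi_n\rangle$. Proposition. For every $r$ and every partial permutation $\beta$ of $\{1,\dots,r\}$ with $\mathrm{dom}(\beta)\neq\emptyset$, with overwhelming probability $\langle\psi_n|\tilde T_\beta^{(n)}|\psi_n\rangle=o(1)$ as $n\to\infty$. Precisely, there is a universal constant $C>0$ such that for all such $r,\beta$: (1)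 $\mathbb E f_n=n^{-2|\mathrm{dom}(\beta)|}$ for all $n\ge1$; (2) for all $n\ge 1$ and $\varepsilon>0$, $$\mathbb P\left(\left|f_n-n^{-2|\mathrm{dom}(\beta)|}\right|>\varepsilon\right)\le 2\exp\left(-C\,n^{2r}\varepsilon^2\right);$$ (3) there is a deterministic sequence $\varepsilon_n\to0$ such that for every integer $D\ge 0$ one has $\mathbb P(|f_n|>\varepsilon_n)=O(n^{-D})$; (4) if the vectors $\psi_n$, $n\ge1$, are defined on a common probability space (with an arbitrary joint distribution), then almost surely $f_n\to0$ as $n\to\infty$. -/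

import Mathlib

open MeasureTheory ProbabilityTheory Filter Topology

/-- The space `(ℂⁿ)^{⊗ r} ⊗ (ℂⁿ)^{⊗ r} = (ℂⁿ)^{⊗ 2r}` with its Hilbert space structure, written in
the product basis: the basis vector with index `s` is the tensor product of the `e_{s(inl x)}` in the
factors `[x, T]` (top) and of the `e_{s(inr y)}` in the factors `[y, B]` (bottom). -/
abbrev TensorSpace (r n : ℕ) : Type := EuclideanSpace ℂ (Fin r ⊕ Fin r → Fin n)

/-- The normalized Bell operator `(1 / n) ∑ᵢⱼ (eᵢ eⱼ^*) ⊗ (fᵢ fⱼ^*)` on `ℂⁿ ⊗ ℂⁿ`. -/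
noncomputable def bellMatrix (n : ℕ) : Matrix (Fin n × Fin n) (Fin n × Fin n) ℂ :=
  (n : ℂ)⁻¹ • ∑ i : Fin n, ∑ j : Fin n,
    Matrix.kroneckerMap (· * ·) (Matrix.single i j (1 : ℂ)) (Matrix.single i j (1 : ℂ))

/-- The operator attached to a partial permutation `β` of `{1, …, r}` (an injective map defined on a
subset, that is, an element of `Fin r ≃. Fin r`): the tensor product of the normalized Bell operators
on the pairs of factors `[x, T]`, `[β x, B]`, for `x` in the domain of `β`, and of the identity on
all the other factors. An entry of a tensor product is the product of the entries of its factors. -/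
noncomputable def partialPermMatrix {r : ℕ} (n : ℕ) (β : Fin r ≃. Fin r) :
    Matrix (Fin r ⊕ Fin r → Fin n) (Fin r ⊕ Fin r → Fin n) ℂ :=
  Matrix.of fun s t =>
    (∏ x : Fin r,
      match β x with
      | some y => bellMatrix n (s (Sum.inl x), s (Sum.inr y)) (t (Sum.inl x), t (Sum.inr y))
      | none => (1 : Matrix (Fin n) (Fin n) ℂ) (s (Sum.inl x)) (t (Sum.inl x))) *
    ∏ y : Fin r,
      match β.symm y with
      | some _ => 1
      | none => (1 : Matrix (Fin n) (Fin n) ℂ) (s (Sum.inr y)) (t (Sum.inr y))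

/-- The cardinality of the domain of a partial permutation. -/
def PEquiv.domCard {r : ℕ} (β : Fin r ≃. Fin r) : ℕ :=
  (Finset.univ.filter fun x => (β x).isSome = true).card

/-- The quantity `⟨ψ | T | ψ⟩`, where `T` is the operator attached to the partial permutation `β`. -/
noncomputable def overlap {r : ℕ} (n : ℕ) (β : Fin r ≃. Fin r) (ψ : TensorSpace r n) : ℂ :=
  inner ℂ ψ (Matrix.toEuclideanLin (partialPermMatrix n β) ψ)

/-- The law of a uniformly random unit vector: the normalized surface measure of the unit sphere,
seen as a measure on the whole space. (A probability measure as soon as the space is not zero.) -/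
noncomputable def uniformUnitVector (r n : ℕ) : Measure (TensorSpace r n) :=
  (((volume : Measure (TensorSpace r n)).toSphere Set.univ)⁻¹ •
    (volume : Measure (TensorSpace r n)).toSphere).map Subtype.val

/-- The events `A n` hold with overwhelming probability under the laws `μ n`: the probability of the
complement is `O(n^{-D})` for every `D`. -/
def WithOverwhelmingProbability {Ω : ℕ → Type} [∀ n, MeasurableSpace (Ω n)]
    (μ : ∀ n, Measure (Ω n)) (A : ∀ n, Set (Ω n)) : Prop :=
  ∀ D : ℕ, ∃ K : ℝ, ∀ n : ℕ, 1 ≤ n → μ n (A n)ᶜ ≤ ENNReal.ofReal (K * ((n : ℝ) ^ D)⁻¹)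

/-! The operator attached to `β` is an orthogonal projection. In the product basis its entries are
`n⁻ᵏ`, with `k = β.domCard`, on a partial equivalence relation whose classes all have `nᵏ` elements,
so it averages over classes and kills the other basis vectors. Counting the classes shows that it
has normalized trace `p = n⁻²ᵏ`. Sign changes and permutations of coordinates preserve the sphere
measure, so the mean of a quadratic form is its normalized trace; this gives (1).

Concentration needs neither Lévy's inequality nor nets. For a projection `T` the overlap of a unit
vector is `‖T ψ‖²`, and the event `q ‖x‖² < ‖T x‖²` is a cone, so its probability on the sphere
equals its probability under a Gaussian on the whole space. On that cone the Gaussian density is at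
most the same density with the range and the kernel of `T` rescaled, and the integral of the latter
is a determinant. The resulting Chernoff bound is at most `exp (-d (q - p)² / 4)`, where `d` is the
real dimension (`normalizedSphere_lt_norm_sq_le`). Applying it to `T` and to `1 - T` gives both
tails, hence (2).

With deviation `n^(-1/2)` the failure probability is at most `2 exp (-n / 2)`, which beats every
power of `n` and gives (3). Borel–Cantelli, whose convergence half needs no independence, then gives
(4) for every joint law. -/

/-! ### Polar coordinates and invariance of the sphere measure -/

section NormalizedSphere

open scoped Pointwise ENNReal

variable {E : Type*} [NormedAddCommGroup E] [NormedSpace ℝ E] [MeasurableSpace E]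

/-- The surface measure of the unit sphere attached to `μ`, normalized to have mass `1`, as a measure
on the whole space. -/
noncomputable def MeasureTheory.Measure.normalizedSphere (μ : Measure E) : Measure E :=
  ((μ.toSphere Set.univ)⁻¹ • μ.toSphere).map Subtype.val

open Measure

variable [BorelSpace E] [FiniteDimensional ℝ E] (μ : Measure E) [μ.IsAddHaarMeasure]

lemma isProbabilityMeasure_normalizedSphere [Nontrivial E] :
    IsProbabilityMeasure μ.normalizedSphere := by
  constructor
  rw [normalizedSphere, map_apply measurable_subtype_coe .univ, Set.preimage_univ,
    Measure.smul_apply, smul_eq_mul]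
  exact ENNReal.inv_mul_cancel (by simpa only [ne_eq, measure_univ_eq_zero] using
    μ.toSphere_ne_zero) (measure_ne_top _ _)

omit [FiniteDimensional ℝ E] [μ.IsAddHaarMeasure] in
lemma ae_normalizedSphere_norm_eq_one : ∀ᵐ x ∂μ.normalizedSphere, ‖x‖ = 1 := by
  rw [normalizedSphere, ae_map_iff measurable_subtype_coe.aemeasurable
    (measurableSet_eq_fun measurable_norm measurable_const)]
  exact ae_of_all _ fun x => by simp

/-- Polar coordinates turn `μ` into a product measure, and `F` sees only the direction while `g`
sees only the radius. -/
lemma lintegral_mul_fun_norm_eq_toSphere {F : E → ℝ≥0∞} (hF : Measurable F)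
    (hhom : ∀ (t : ℝ) (x : E), 0 < t → F (t • x) = F x) {g : ℝ → ℝ≥0∞} (hg : Measurable g)
    [Nontrivial E] :
    ∫⁻ x, F x * g ‖x‖ ∂μ = (∫⁻ θ, F θ ∂μ.toSphere) *
      ∫⁻ t : Set.Ioi (0 : ℝ), g t ∂(volumeIoiPow (Module.finrank ℝ E - 1)) := by
  have hmp := μ.measurePreserving_homeomorphUnitSphereProd
  calc ∫⁻ x, F x * g ‖x‖ ∂μ
      = ∫⁻ x : ({(0)}ᶜ : Set E), F x * g ‖(x : E)‖ ∂(μ.comap (↑)) := by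
        rw [lintegral_subtype_comap (measurableSet_singleton _).compl fun x => F x * g ‖x‖,
          restrict_compl_singleton]
    _ = ∫⁻ z : Metric.sphere (0 : E) 1 × Set.Ioi (0 : ℝ), F z.1 * g z.2
          ∂(μ.toSphere.prod (volumeIoiPow (Module.finrank ℝ E - 1))) := by
        rw [← hmp.lintegral_comp_emb (Homeomorph.measurableEmbedding _)]
        refine lintegral_congr fun x => ?_
        have hx : 0 < ‖(x : E)‖ := norm_pos_iff.2 x.2
        rw [homeomorphUnitSphereProd_apply_snd_coe, homeomorphUnitSphereProd_apply_fst_coe,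
          hhom _ _ (inv_pos.2 hx)]
    _ = _ := lintegral_prod_mul (f := fun θ : Metric.sphere (0 : E) 1 => F θ)
        (g := fun t : Set.Ioi (0 : ℝ) => g t)
        (hF.comp measurable_subtype_coe).aemeasurable (hg.comp measurable_subtype_coe).aemeasurable

/-- Direction and radius are independent under a rotation-free radial weight. With `F` the indicator
of a cone and `g` Gaussian, this converts sphere probabilities into Gaussian integrals. The radial
factor is identified by the case `F = 1` of the previous lemma. -/
lemma lintegral_mul_fun_norm_eq_normalizedSphere {F : E → ℝ≥0∞} (hF : Measurable F)
    (hhom : ∀ (t : ℝ) (x : E), 0 < t → F (t • x) = F x) {g : ℝ → ℝ≥0∞} (hg : Measurable g)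
    [Nontrivial E] :
    ∫⁻ x, F x * g ‖x‖ ∂μ = (∫⁻ x, F x ∂μ.normalizedSphere) * ∫⁻ x, g ‖x‖ ∂μ := by
  have h1 := lintegral_mul_fun_norm_eq_toSphere μ (F := fun _ => 1) measurable_const
    (fun _ _ _ => rfl) hg
  simp only [one_mul, lintegral_one] at h1
  have h0 : μ.toSphere Set.univ ≠ 0 := by
    simpa only [ne_eq, measure_univ_eq_zero] using μ.toSphere_ne_zero
  rw [lintegral_mul_fun_norm_eq_toSphere μ hF hhom hg, h1, normalizedSphere,
    lintegral_map hF measurable_subtype_coe, lintegral_smul_measure, smul_eq_mul, ← mul_assoc,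
    mul_right_comm _ _ (μ.toSphere Set.univ), ENNReal.inv_mul_cancel h0 (measure_ne_top _ _),
    one_mul]

-- The surface measure of a set is, up to a dimensional factor, the `μ`-measure of the truncated
-- cone over it, and a linear isometry carries such cones to such cones.
omit [FiniteDimensional ℝ E] [μ.IsAddHaarMeasure] in
lemma normalizedSphere_map_linearIsometryEquiv (e : E ≃ₗᵢ[ℝ] E) (he : MeasurePreserving e μ μ) :
    μ.normalizedSphere.map e = μ.normalizedSphere := by
  have key : ∀ s : Set E, MeasurableSet s → μ.toSphere (Subtype.val ⁻¹' (e ⁻¹' s)) =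
      μ.toSphere (Subtype.val ⁻¹' s) := by
    intro s hs
    have hsub : Set.Ioo (0 : ℝ) 1 • ((↑) '' ((Subtype.val : Metric.sphere (0 : E) 1 → E) ⁻¹'
        (e ⁻¹' s))) = e ⁻¹' (Set.Ioo (0 : ℝ) 1 • ((↑) '' ((Subtype.val :
        Metric.sphere (0 : E) 1 → E) ⁻¹' s))) := by
      ext x
      simp only [Set.mem_smul, Set.mem_image, Set.mem_preimage, Subtype.exists,
        mem_sphere_zero_iff_norm, exists_and_left]
      constructor
      · rintro ⟨t, ht, _, ⟨y, hy, ⟨hy1, rfl⟩⟩, rfl⟩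
        exact ⟨t, ht, e y, ⟨e y, hy, by simpa using hy1, rfl⟩, by simp⟩
      · rintro ⟨t, ht, _, ⟨y, hy, ⟨hy1, rfl⟩⟩, hx⟩
        exact ⟨t, ht, e.symm y, ⟨e.symm y, by simpa using hy, by simpa using hy1, rfl⟩,
          e.injective (by simpa using hx)⟩
    rw [toSphere_apply' _ (measurable_subtype_coe (e.continuous.measurable hs)),
      toSphere_apply' _ (measurable_subtype_coe hs), hsub,
      he.measure_preimage_emb e.toHomeomorph.measurableEmbedding]
  ext s hs
  rw [map_apply e.continuous.measurable hs, normalizedSphere,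
    map_apply measurable_subtype_coe (e.continuous.measurable hs),
    map_apply measurable_subtype_coe hs, Measure.smul_apply, Measure.smul_apply, key s hs]

end NormalizedSphere

/-! ### Chernoff bound for the norm of a projection -/

section Chernoff

open scoped ENNReal

variable {E : Type*} [NormedAddCommGroup E] [NormedSpace ℝ E]

lemma det_smul_add_smul_of_isIdempotentElem {V : Type*} [AddCommGroup V] [Module ℝ V]
    [FiniteDimensional ℝ V] {T : V →ₗ[ℝ] V} (hT : IsIdempotentElem T) (a b : ℝ) :
    LinearMap.det (a • T + b • (1 - T)) = a ^ Module.finrank ℝ (LinearMap.range T) *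
      b ^ (Module.finrank ℝ V - Module.finrank ℝ (LinearMap.range T)) := by
  have hp := LinearMap.IsIdempotentElem.isProj_range T hT
  set e := (LinearMap.range T).prodEquivOfIsCompl (LinearMap.ker T) hp.isCompl
  have hconj : a • T + b • (1 - T) =
      (e : (LinearMap.range T × LinearMap.ker T) →ₗ[ℝ] V) ∘ₗ (LinearMap.prodMap (a • LinearMap.id) (b • LinearMap.id)) ∘ₗ
        (e.symm : V →ₗ[ℝ] (LinearMap.range T × LinearMap.ker T)) := by
    ext x
    obtain ⟨⟨y, z⟩, rfl⟩ := e.surjective x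
    have hy : T y = y := hp.map_id _ y.2
    have hz : T z = 0 := z.2
    simp [e, hy, hz, smul_sub]
  rw [hconj, LinearMap.det_conj, LinearMap.det_prodMap]
  have := LinearMap.finrank_range_add_finrank_ker T
  rw [LinearMap.det_smul, LinearMap.det_smul, LinearMap.det_id, LinearMap.det_id, mul_one, mul_one,
    show Module.finrank ℝ V - Module.finrank ℝ (LinearMap.range T) =
      Module.finrank ℝ (LinearMap.ker T) by omega]

/-- The Pythagorean hypothesis stands for orthogonality of the projection, so that only a real
normed space is needed. -/
lemma norm_smul_add_smul_sq {T : E →ₗ[ℝ] E} (hT : IsIdempotentElem T)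
    (hpyth : ∀ x, ‖x‖ ^ 2 = ‖T x‖ ^ 2 + ‖x - T x‖ ^ 2) (a b : ℝ) (x : E) :
    ‖(a • T + b • (1 - T)) x‖ ^ 2 = a ^ 2 * ‖T x‖ ^ 2 + b ^ 2 * ‖x - T x‖ ^ 2 := by
  have hTT : T (T x) = T x := LinearMap.congr_fun hT x
  rw [hpyth]
  have h1 : T ((a • T + b • (1 - T)) x) = a • T x := by simp [hTT]
  have h2 : (a • T + b • (1 - T)) x - a • T x = b • (x - T x) := by simp
  rw [h1, h2, norm_smul, norm_smul, mul_pow, mul_pow, Real.norm_eq_abs, Real.norm_eq_abs, sq_abs,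
    sq_abs]

variable [MeasurableSpace E] [BorelSpace E] [FiniteDimensional ℝ E] (μ : Measure E)
  [μ.IsAddHaarMeasure]

/-- The integrand is the standard Gaussian composed with `a • T + b • (1 - T)`, so a linear change
of variables produces the inverse determinant. -/
lemma lintegral_exp_neg_quadratic {T : E →ₗ[ℝ] E} (hT : IsIdempotentElem T)
    (hpyth : ∀ x, ‖x‖ ^ 2 = ‖T x‖ ^ 2 + ‖x - T x‖ ^ 2) {a b : ℝ} (ha : 0 < a) (hb : 0 < b) :
    ∫⁻ x, ENNReal.ofReal (Real.exp (-(a ^ 2 * ‖T x‖ ^ 2 + b ^ 2 * ‖x - T x‖ ^ 2))) ∂μ =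
      ENNReal.ofReal (a ^ Module.finrank ℝ (LinearMap.range T) *
        b ^ (Module.finrank ℝ E - Module.finrank ℝ (LinearMap.range T)))⁻¹ *
      ∫⁻ x, ENNReal.ofReal (Real.exp (-‖x‖ ^ 2)) ∂μ := by
  set L := a • T + b • (1 - T) with hL
  have hdet := det_smul_add_smul_of_isIdempotentElem hT a b
  rw [← hL] at hdet
  have hpos : 0 < LinearMap.det L := by rw [hdet]; positivity
  have hLc : Continuous L := L.continuous_of_finiteDimensional
  have hmap := Measure.map_linearMap_addHaar_eq_smul_addHaar μ hpos.ne'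
  rw [abs_of_pos (inv_pos.2 hpos), hdet] at hmap
  rw [← smul_eq_mul, ← lintegral_smul_measure, ← hmap, lintegral_map (by fun_prop) hLc.measurable]
  refine lintegral_congr fun x => ?_
  rw [← norm_smul_add_smul_sq hT hpyth a b x]

lemma lintegral_exp_neg_norm_sq_ne_zero_ne_top [Nontrivial E] :
    ∫⁻ x, ENNReal.ofReal (Real.exp (-‖x‖ ^ 2)) ∂μ ≠ 0 ∧
      ∫⁻ x, ENNReal.ofReal (Real.exp (-‖x‖ ^ 2)) ∂μ ≠ ∞ := by
  have h : Integrable (fun x => Real.exp (-‖x‖ ^ 2)) μ := by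
    rw [integrable_fun_norm_addHaar μ (f := fun t => Real.exp (-t ^ 2))]
    have := integrableOn_rpow_mul_exp_neg_mul_sq one_pos
      (s := ((Module.finrank ℝ E - 1 : ℕ) : ℝ)) (neg_one_lt_zero.trans_le (Nat.cast_nonneg _))
    simpa [Real.rpow_natCast] using this
  rw [← ofReal_integral_eq_lintegral_ofReal h (ae_of_all _ fun x => (Real.exp_pos _).le)]
  exact ⟨(ENNReal.ofReal_pos.2 (integral_exp_pos h)).ne', ENNReal.ofReal_ne_top⟩

lemma sqrt_mul_le_of_mem_unitInterval {p q : ℝ} (hp : 0 ≤ p) (hq : 0 ≤ q) (hp1 : p ≤ 1)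
    (hq1 : q ≤ 1) : √(p * q) ≤ (p + q) / 2 - (q - p) ^ 2 / 8 := by
  apply Real.sqrt_le_iff.2
  constructor
  · nlinarith
  · nlinarith [mul_nonneg (sq_nonneg (q - p)) (by linarith : 0 ≤ 2 - p - q),
      sq_nonneg ((q - p) ^ 2)]

/-- The left side is `exp (-(d / 2) KL(p ‖ q))` for Bernoulli parameters. Applying `y ≤ exp (y - 1)`
to the square roots replaces the divergence by the affinity `√(p q) + √((1 - p) (1 - q))`, which is
at most `1 - (q - p)² / 4`. -/
lemma sqrt_div_pow_mul_sqrt_div_pow_le {p q : ℝ} (hp : 0 < p) (hpq : p < q) (hq : q < 1)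
    {k d : ℕ} (hkd : k ≤ d) (hk : (k : ℝ) = p * d) :
    (√(p / q) ^ k * √((1 - p) / (1 - q)) ^ (d - k))⁻¹ ≤
      Real.exp (-(d * (q - p) ^ 2 / 4)) := by
  have h0 : 0 < 1 - q := by linarith
  have h1 : 0 < 1 - p := by linarith
  have hq0 : 0 < q := hp.trans hpq
  rw [mul_inv, ← inv_pow, ← inv_pow, ← Real.sqrt_inv, ← Real.sqrt_inv, inv_div, inv_div]
  have e1 : √(q / p) ≤ Real.exp (√(q / p) - 1) := by
    simpa using Real.add_one_le_exp (√(q / p) - 1)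
  have e2 : √((1 - q) / (1 - p)) ≤ Real.exp (√((1 - q) / (1 - p)) - 1) := by
    simpa using Real.add_one_le_exp (√((1 - q) / (1 - p)) - 1)
  calc √(q / p) ^ k * √((1 - q) / (1 - p)) ^ (d - k)
      ≤ Real.exp (√(q / p) - 1) ^ k * Real.exp (√((1 - q) / (1 - p)) - 1) ^ (d - k) := by gcongr
    _ = Real.exp (d * (√(p * q) + √((1 - p) * (1 - q)) - 1)) := by
      rw [← Real.exp_nat_mul, ← Real.exp_nat_mul, ← Real.exp_add, Nat.cast_sub hkd, hk]
      have r1 : p * √(q / p) = √(p * q) := by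
        rw [show p * q = p ^ 2 * (q / p) by field_simp, Real.sqrt_mul (by positivity),
          Real.sqrt_sq hp.le]
      have r2 : (1 - p) * √((1 - q) / (1 - p)) = √((1 - p) * (1 - q)) := by
        rw [show (1 - p) * (1 - q) = (1 - p) ^ 2 * ((1 - q) / (1 - p)) by field_simp,
          Real.sqrt_mul (by positivity), Real.sqrt_sq h1.le]
      rw [← r1, ← r2]
      ring_nf
    _ ≤ _ := by
      have s1 := sqrt_mul_le_of_mem_unitInterval hp.le hq0.le (by linarith) hq.le
      have s2 := sqrt_mul_le_of_mem_unitInterval h1.le h0.le (by linarith) (by linarith)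
      apply Real.exp_le_exp.2
      have hd : (0 : ℝ) ≤ d := d.cast_nonneg
      nlinarith [mul_le_mul_of_nonneg_left (add_le_add s1 s2) hd]

theorem normalizedSphere_lt_norm_sq_le [Nontrivial E] {T : E →ₗ[ℝ] E} (hT : IsIdempotentElem T)
    (hpyth : ∀ x, ‖x‖ ^ 2 = ‖T x‖ ^ 2 + ‖x - T x‖ ^ 2) {p q : ℝ}
    (hp : (Module.finrank ℝ (LinearMap.range T) : ℝ) = p * Module.finrank ℝ E) (hpq : p < q) :
    μ.normalizedSphere {x | q * ‖x‖ ^ 2 < ‖T x‖ ^ 2} ≤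
      ENNReal.ofReal (Real.exp (-(Module.finrank ℝ E * (q - p) ^ 2 / 4))) := by
  set d := Module.finrank ℝ E
  set k := Module.finrank ℝ (LinearMap.range T)
  have hd : 0 < (d : ℝ) := Nat.cast_pos.2 Module.finrank_pos
  have hp0 : 0 ≤ p := by
    have : 0 ≤ p * d := hp ▸ k.cast_nonneg
    exact nonneg_of_mul_nonneg_left this hd
  have hkd : k ≤ d := Submodule.finrank_le _
  have hTle : ∀ x, ‖T x‖ ^ 2 ≤ ‖x‖ ^ 2 := fun x => by rw [hpyth x]; nlinarith [sq_nonneg ‖x - T x‖]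
  -- The cases `p = 0` and `q ≥ 1` are set apart because the scale factors `√(p / q)` and `√((1 - p)
  -- / (1 - q))` used below must be positive; in both the event is empty.
  rcases hp0.eq_or_lt with rfl | hp0
  · have hT0 : T = 0 := by
      rw [← LinearMap.range_eq_bot, ← Submodule.finrank_eq_zero (R := ℝ)]
      have : (k : ℝ) = 0 := by simpa using hp
      exact_mod_cast this
    have : {x : E | q * ‖x‖ ^ 2 < ‖T x‖ ^ 2} = ∅ := by
      ext x
      simp only [hT0, LinearMap.zero_apply, norm_zero, Set.mem_ofPred_eq, Set.mem_empty_iff_false,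
        iff_false, not_lt]
      nlinarith [sq_nonneg ‖x‖]
    simp [this]
  rcases le_or_gt 1 q with hq | hq
  · have : {x : E | q * ‖x‖ ^ 2 < ‖T x‖ ^ 2} = ∅ := by
      ext x
      simp only [Set.mem_ofPred_eq, Set.mem_empty_iff_false, iff_false, not_lt]
      nlinarith [hTle x, sq_nonneg ‖x‖]
    simp [this]
  have hq0 : 0 < q := hp0.trans hpq
  have h1q : 0 < 1 - q := by linarith
  have h1p : 0 < 1 - p := by linarith
  have hTc : Continuous T := T.continuous_of_finiteDimensional
  set A := {x : E | q * ‖x‖ ^ 2 < ‖T x‖ ^ 2} with hA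
  have hAm : MeasurableSet A := (isOpen_lt (by fun_prop) (by fun_prop)).measurableSet
  obtain ⟨hZ0, hZt⟩ := lintegral_exp_neg_norm_sq_ne_zero_ne_top μ
  set Z := ∫⁻ x, ENNReal.ofReal (Real.exp (-‖x‖ ^ 2)) ∂μ
  have hcone := lintegral_mul_fun_norm_eq_normalizedSphere μ (F := A.indicator 1)
    (measurable_one.indicator hAm) (fun t x ht => by
      have : t • x ∈ A ↔ x ∈ A := by
        simp only [hA, Set.mem_ofPred_eq, map_smul, norm_smul, mul_pow, Real.norm_eq_abs, sq_abs]
        rw [mul_left_comm, mul_lt_mul_iff_right₀ (by positivity)]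
      simp [Set.indicator_apply, this]) (g := fun t => ENNReal.ofReal (Real.exp (-t ^ 2)))
      (by fun_prop)
  rw [lintegral_indicator_one hAm] at hcone
  -- These scales are the optimal exponential tilt: they move the typical value of `‖T x‖² / ‖x‖²`
  -- from `p` to `q`.
  have hquad := lintegral_exp_neg_quadratic μ hT hpyth (a := √(p / q))
    (b := √((1 - p) / (1 - q))) (by positivity) (by positivity)
  have hle : ∫⁻ x, A.indicator 1 x * ENNReal.ofReal (Real.exp (-‖x‖ ^ 2)) ∂μ ≤
      ∫⁻ x, ENNReal.ofReal (Real.exp (-(√(p / q) ^ 2 * ‖T x‖ ^ 2 +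
        √((1 - p) / (1 - q)) ^ 2 * ‖x - T x‖ ^ 2))) ∂μ := by
    refine lintegral_mono fun x => ?_
    by_cases hx : x ∈ A
    · simp only [Set.indicator_of_mem hx, Pi.one_apply, one_mul]
      apply ENNReal.ofReal_le_ofReal
      apply Real.exp_le_exp.2
      rw [Real.sq_sqrt (by positivity), Real.sq_sqrt (by positivity)]
      have hx' : q * (‖T x‖ ^ 2 + ‖x - T x‖ ^ 2) < ‖T x‖ ^ 2 := by rw [← hpyth x]; exact hx
      -- The tilted form differs from `‖x‖²` by a nonnegative multiple of `q ‖x‖² - ‖T x‖²`, which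
      -- is negative on the cone.
      have hid : p / q * ‖T x‖ ^ 2 + (1 - p) / (1 - q) * ‖x - T x‖ ^ 2 =
          ‖T x‖ ^ 2 + ‖x - T x‖ ^ 2 + (q - p) / (q * (1 - q)) *
            (q * (‖T x‖ ^ 2 + ‖x - T x‖ ^ 2) - ‖T x‖ ^ 2) := by
        field_simp
        ring
      rw [hid, hpyth x]
      have hc : 0 ≤ (q - p) / (q * (1 - q)) := div_nonneg (by linarith) (by positivity)
      nlinarith
    · simp [Set.indicator_of_notMem hx]
  rw [hcone, hquad] at hle
  exact ((ENNReal.mul_le_mul_iff_left hZ0 hZt).1 hle).trans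
    (ENNReal.ofReal_le_ofReal (sqrt_div_pow_mul_sqrt_div_pow_le hp0 hpq hq hkd hp))

end Chernoff

/-! ### The operator of a partial permutation is a projection with known trace -/

section PartialPermMatrix

open scoped Matrix

variable {r : ℕ} {n : ℕ}

lemma bellMatrix_apply (a b c d : Fin n) :
    bellMatrix n (a, b) (c, d) = (n : ℂ)⁻¹ * if a = b ∧ c = d then 1 else 0 := by
  simp only [bellMatrix, Matrix.smul_apply, Matrix.sum_apply, Matrix.kroneckerMap_apply,
    smul_eq_mul, Matrix.single_apply]
  congr 1
  by_cases h : a = b ∧ c = d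
  · obtain ⟨rfl, rfl⟩ := h
    rw [Finset.sum_eq_single a (by intro i _ hi; simp [hi]) (by simp),
      Finset.sum_eq_single c (by intro j _ hj; simp [hj]) (by simp)]
    simp
  · rw [if_neg h]
    refine Finset.sum_eq_zero fun i _ => Finset.sum_eq_zero fun j _ => ?_
    by_contra hne
    have := left_ne_zero_of_mul hne
    have := right_ne_zero_of_mul hne
    simp_all

/-- The basis vectors that take the same value on matched factors. -/
def PEquiv.IsConstant (β : Fin r ≃. Fin r) (s : Fin r ⊕ Fin r → Fin n) : Prop :=
  ∀ x y, β x = some y → s (Sum.inl x) = s (Sum.inr y)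

/-- Two basis vectors agree on the factors that `β` does not match. -/
def PEquiv.AgreeOffMatched (β : Fin r ≃. Fin r) (s t : Fin r ⊕ Fin r → Fin n) : Prop :=
  (∀ x, β x = none → s (Sum.inl x) = t (Sum.inl x)) ∧
    ∀ y, β.symm y = none → s (Sum.inr y) = t (Sum.inr y)

/-- The pairs of basis vectors at which the matrix of a partial permutation does not vanish. -/
def PEquiv.Linked (β : Fin r ≃. Fin r) (s t : Fin r ⊕ Fin r → Fin n) : Prop :=
  β.IsConstant s ∧ β.IsConstant t ∧ β.AgreeOffMatched s t

lemma PEquiv.Linked.symm {β : Fin r ≃. Fin r} {s t : Fin r ⊕ Fin r → Fin n}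
    (h : β.Linked s t) : β.Linked t s :=
  ⟨h.2.1, h.1, fun x hx => (h.2.2.1 x hx).symm, fun y hy => (h.2.2.2 y hy).symm⟩

lemma PEquiv.Linked.trans {β : Fin r ≃. Fin r} {s t u : Fin r ⊕ Fin r → Fin n}
    (h : β.Linked s t) (h' : β.Linked t u) : β.Linked s u :=
  ⟨h.1, h'.2.1, fun x hx => (h.2.2.1 x hx).trans (h'.2.2.1 x hx),
    fun y hy => (h.2.2.2 y hy).trans (h'.2.2.2 y hy)⟩

open Classical in
lemma partialPermMatrix_apply (β : Fin r ≃. Fin r) (s t : Fin r ⊕ Fin r → Fin n) :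
    partialPermMatrix n β s t = ((n : ℂ)⁻¹) ^ β.domCard * if β.Linked s t then 1 else 0 := by
  have h1 : ∀ x : Fin r, (match β x with
      | some y => bellMatrix n (s (Sum.inl x), s (Sum.inr y)) (t (Sum.inl x), t (Sum.inr y))
      | none => (1 : Matrix (Fin n) (Fin n) ℂ) (s (Sum.inl x)) (t (Sum.inl x))) =
      (if (β x).isSome then (n : ℂ)⁻¹ else 1) *
        if (∀ y, β x = some y → s (Sum.inl x) = s (Sum.inr y) ∧ t (Sum.inl x) = t (Sum.inr y)) ∧
          (β x = none → s (Sum.inl x) = t (Sum.inl x)) then 1 else 0 := by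
    intro x
    rcases β x with _ | y
    · simp [Matrix.one_apply]
    · simp [bellMatrix_apply]
  have h2 : ∀ y : Fin r, (match β.symm y with
      | some _ => 1
      | none => (1 : Matrix (Fin n) (Fin n) ℂ) (s (Sum.inr y)) (t (Sum.inr y))) =
      if (β.symm y = none → s (Sum.inr y) = t (Sum.inr y)) then 1 else 0 := by
    intro y
    rcases β.symm y with _ | x <;> simp [Matrix.one_apply]
  refine (congrArg₂ (· * ·) (Finset.prod_congr rfl fun x _ => h1 x)
    (Finset.prod_congr rfl fun y _ => h2 y)).trans ?_
  rw [Finset.prod_mul_distrib, Finset.prod_ite_zero,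
    Finset.prod_ite_zero, mul_assoc, ← Finset.prod_filter, Finset.prod_const, ite_zero_mul_ite_zero]
  simp only [Finset.prod_const_one, mul_one, PEquiv.domCard]
  congr 1
  refine if_congr ?_ rfl rfl
  simp only [Finset.mem_univ, true_imp_iff, PEquiv.Linked, PEquiv.IsConstant,
    PEquiv.AgreeOffMatched]
  constructor
  · rintro ⟨h, h'⟩
    exact ⟨fun x y hxy => ((h x).1 y hxy).1, fun x y hxy => ((h x).1 y hxy).2,
      fun x => (h x).2, h'⟩
  · rintro ⟨hs, ht, h, h'⟩
    exact ⟨fun x => ⟨fun y hxy => ⟨hs x y hxy, ht x y hxy⟩, h x⟩, h'⟩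

lemma card_subtype_isSome (β : Fin r ≃. Fin r) :
    Fintype.card {x // (β x).isSome = true} = β.domCard := by
  rw [Fintype.card_subtype, PEquiv.domCard]

lemma PEquiv.domCard_le (β : Fin r ≃. Fin r) : β.domCard ≤ r := by
  simpa [PEquiv.domCard] using Finset.card_filter_le Finset.univ fun x => (β x).isSome = true

lemma PEquiv.domCard_symm (β : Fin r ≃. Fin r) : β.symm.domCard = β.domCard := by
  refine Finset.card_bij' (fun y hy => (β.symm y).get (Finset.mem_filter.1 hy).2)
    (fun x hx => (β x).get (Finset.mem_filter.1 hx).2) ?_ ?_ ?_ ?_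
  · intro y hy
    have : β ((β.symm y).get (Finset.mem_filter.1 hy).2) = some y :=
      (PEquiv.eq_some_iff β).1 (by simp)
    simp [this]
  · intro x hx
    have : β.symm ((β x).get (Finset.mem_filter.1 hx).2) = some x :=
      (PEquiv.eq_some_iff β).2 (by simp)
    simp [this]
  · intro y hy
    have : β ((β.symm y).get (Finset.mem_filter.1 hy).2) = some y :=
      (PEquiv.eq_some_iff β).1 (by simp)
    simp [this]
  · intro x hx
    have : β.symm ((β x).get (Finset.mem_filter.1 hx).2) = some x :=
      (PEquiv.eq_some_iff β).2 (by simp)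
    simp [this]

lemma card_subtype_symm_eq_none (β : Fin r ≃. Fin r) :
    Fintype.card {y // β.symm y = none} = r - β.domCard := by
  have h := Finset.card_filter_add_card_filter_not (s := (Finset.univ : Finset (Fin r)))
    (fun y => (β.symm y).isSome = true)
  rw [← PEquiv.domCard, PEquiv.domCard_symm, Finset.card_univ, Fintype.card_fin] at h
  rw [Fintype.card_subtype]
  simp only [Bool.not_eq_true, Option.isSome_eq_false_iff, Option.isNone_iff_eq_none] at h
  omega

-- A linked `t` is free exactly in the matched top factors: the matched bottom factors repeat them,
-- and the unmatched factors are copied from `s`.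
open Classical in
lemma card_linked {β : Fin r ≃. Fin r} {s : Fin r ⊕ Fin r → Fin n} (hs : β.IsConstant s) :
    Fintype.card {t // β.Linked s t} = n ^ β.domCard := by
  have hget : ∀ y (h : (β.symm y).isSome = true), β ((β.symm y).get h) = some y := fun y h =>
    (PEquiv.eq_some_iff β).1 (by simp)
  let e : {t // β.Linked s t} ≃ ({x // (β x).isSome = true} → Fin n) :=
    { toFun := fun t x => t.1 (Sum.inl x)
      invFun := fun g => ⟨Sum.elim (fun x => if h : (β x).isSome then g ⟨x, h⟩ else s (Sum.inl x))
        (fun y => if h : (β.symm y).isSome then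
          g ⟨(β.symm y).get h, by simp [hget y h]⟩ else s (Sum.inr y)), by
          refine ⟨hs, fun x y hxy => ?_, fun x hx => ?_, fun y hy => ?_⟩
          · have hyx : β.symm y = some x := (PEquiv.eq_some_iff β).2 hxy
            simp [hxy, hyx]
          · simp [hx]
          · simp [hy]⟩
      left_inv := by
        rintro ⟨t, ht⟩
        ext z
        rcases z with x | y
        · by_cases h : (β x).isSome
          · simp [h]
          · have hx : β x = none := by simpa using h
            simp [hx, ht.2.2.1 x hx]
        · by_cases h : (β.symm y).isSome
          · simp [h, ht.2.1 _ _ (hget y h)]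
          · have hy : β.symm y = none := by simpa using h
            simp [hy, ht.2.2.2 y hy]
      right_inv := by
        intro g
        ext ⟨x, hx⟩
        simp [hx] }
  rw [Fintype.card_congr e, Fintype.card_fun, card_subtype_isSome, Fintype.card_fin]

-- All `r` top factors and the `r - β.domCard` unmatched bottom factors are free; the matched bottom
-- factors are forced.
open Classical in
lemma card_isConstant (β : Fin r ≃. Fin r) :
    Fintype.card {s : Fin r ⊕ Fin r → Fin n // β.IsConstant s} = n ^ (2 * r - β.domCard) := by
  have hget : ∀ y (h : (β.symm y).isSome = true), β ((β.symm y).get h) = some y := fun y h =>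
    (PEquiv.eq_some_iff β).1 (by simp)
  let e : {s : Fin r ⊕ Fin r → Fin n // β.IsConstant s} ≃
      (Fin r ⊕ {y // β.symm y = none} → Fin n) :=
    { toFun := fun s => s.1 ∘ Sum.map id Subtype.val
      invFun := fun g => ⟨Sum.elim (fun x => g (Sum.inl x))
        (fun y => if h : (β.symm y).isSome then g (Sum.inl ((β.symm y).get h)) else
          g (Sum.inr ⟨y, by simpa using h⟩)), by
          intro x y hxy
          have hyx : β.symm y = some x := (PEquiv.eq_some_iff β).2 hxy
          simp [hyx]⟩
      left_inv := by
        rintro ⟨s, hs⟩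
        ext z
        rcases z with x | y
        · simp
        · by_cases h : (β.symm y).isSome
          · simp [h, hs _ _ (hget y h)]
          · simp [h]
      right_inv := by
        intro g
        ext z
        rcases z with x | ⟨y, hy⟩
        · simp
        · simp [hy] }
  rw [Fintype.card_congr e, Fintype.card_fun, Fintype.card_sum, card_subtype_symm_eq_none,
    Fintype.card_fin, Fintype.card_fin]
  congr 1
  have := β.domCard_le
  omega

lemma isHermitian_partialPermMatrix (n : ℕ) (β : Fin r ≃. Fin r) :
    (partialPermMatrix n β).IsHermitian := by
  classical
  ext s t
  rw [Matrix.conjTranspose_apply, partialPermMatrix_apply, partialPermMatrix_apply,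
    if_congr (⟨PEquiv.Linked.symm, PEquiv.Linked.symm⟩ : β.Linked t s ↔ β.Linked s t) rfl rfl]
  split_ifs <;> simp

/-- `Linked` is symmetric and transitive. In the square, the intermediate indices between linked `s`
and `u` are the whole class of `s`, and its size `n ^ β.domCard` cancels one of the two normalizing
factors. -/
lemma isIdempotentElem_partialPermMatrix (hn : 1 ≤ n) (β : Fin r ≃. Fin r) :
    IsIdempotentElem (partialPermMatrix n β) := by
  classical
  have hn0 : (n : ℂ) ≠ 0 := by exact_mod_cast (by omega : n ≠ 0)
  ext s u
  simp only [Matrix.mul_apply, partialPermMatrix_apply]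
  by_cases hsu : β.Linked s u
  · have h : ∀ t, (n : ℂ)⁻¹ ^ β.domCard * (if β.Linked s t then 1 else 0) *
        ((n : ℂ)⁻¹ ^ β.domCard * (if β.Linked t u then 1 else 0)) =
        if β.Linked s t then (n : ℂ)⁻¹ ^ β.domCard * (n : ℂ)⁻¹ ^ β.domCard else 0 := by
      intro t
      by_cases hst : β.Linked s t
      · simp [hst, hst.symm.trans hsu]
      · simp [hst]
    rw [Finset.sum_congr rfl fun t _ => h t, ← Finset.sum_filter, Finset.sum_const,
      ← Fintype.card_subtype, card_linked hsu.1, if_pos hsu, nsmul_eq_mul]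
    push_cast
    rw [← mul_assoc, ← mul_pow, mul_inv_cancel₀ hn0, one_pow, one_mul, mul_one]
  · rw [if_neg hsu, mul_zero]
    refine Finset.sum_eq_zero fun t _ => ?_
    by_cases hst : β.Linked s t
    · have : ¬ β.Linked t u := fun h => hsu (hst.trans h)
      simp [this]
    · simp [hst]

lemma trace_partialPermMatrix (hn : 1 ≤ n) (β : Fin r ≃. Fin r) :
    (partialPermMatrix n β).trace = ((n : ℂ) ^ (2 * β.domCard))⁻¹ * (n : ℂ) ^ (2 * r) := by
  classical
  have hn0 : (n : ℂ) ≠ 0 := by exact_mod_cast (by omega : n ≠ 0)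
  have hself : ∀ s : Fin r ⊕ Fin r → Fin n, β.Linked s s ↔ β.IsConstant s := fun s =>
    ⟨fun h => h.1, fun h => ⟨h, h, fun _ _ => rfl, fun _ _ => rfl⟩⟩
  simp only [Matrix.trace, Matrix.diag_apply, partialPermMatrix_apply, hself]
  rw [← Finset.mul_sum, Finset.sum_boole, ← Fintype.card_subtype, card_isConstant]
  have := β.domCard_le
  rw [show 2 * r = (2 * r - β.domCard) + β.domCard by omega, two_mul β.domCard, pow_add, pow_add]
  push_cast
  have e : 2 * r - β.domCard + β.domCard - β.domCard = 2 * r - β.domCard := by omega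
  rw [e]
  field_simp
  rw [← mul_pow, one_div_mul_cancel hn0, one_pow]

end PartialPermMatrix

/-! ### Mean and concentration of quadratic forms on the sphere -/

section QuadraticForm

open Measure

open scoped ENNReal ComplexConjugate

lemma Continuous.integrable_normalizedSphere {E F : Type*} [NormedAddCommGroup E] [NormedSpace ℝ E]
    [MeasurableSpace E] [BorelSpace E] [FiniteDimensional ℝ E] [Nontrivial E] (μ : Measure E)
    [μ.IsAddHaarMeasure] [NormedAddCommGroup F] {f : E → F} (hf : Continuous f) :
    Integrable f μ.normalizedSphere := by
  have h0 : μ.toSphere Set.univ ≠ 0 := by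
    simpa only [ne_eq, measure_univ_eq_zero] using μ.toSphere_ne_zero
  have : ProperSpace E := FiniteDimensional.proper ℝ E
  have hc : Continuous fun θ : Metric.sphere (0 : E) 1 => f θ := hf.comp continuous_subtype_val
  have hi : Integrable (fun θ : Metric.sphere (0 : E) 1 => f θ) μ.toSphere :=
    hc.integrable_of_hasCompactSupport (HasCompactSupport.of_compactSpace _)
  rw [normalizedSphere, (MeasurableEmbedding.subtype_coe
    Metric.isClosed_sphere.measurableSet).integrable_map_iff]
  exact hi.smul_measure (ENNReal.inv_ne_top.2 h0)

variable {ι : Type*} [Fintype ι] [DecidableEq ι]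

omit [DecidableEq ι] in
lemma integral_normalizedSphere_comp (e : EuclideanSpace ℂ ι ≃ₗᵢ[ℝ] EuclideanSpace ℂ ι)
    (f : EuclideanSpace ℂ ι → ℂ) :
    ∫ x, f (e x) ∂(volume : Measure (EuclideanSpace ℂ ι)).normalizedSphere =
      ∫ x, f x ∂(volume : Measure (EuclideanSpace ℂ ι)).normalizedSphere := by
  have h : MeasurePreserving e (volume : Measure (EuclideanSpace ℂ ι)).normalizedSphere
      (volume : Measure (EuclideanSpace ℂ ι)).normalizedSphere :=
    ⟨e.continuous.measurable, normalizedSphere_map_linearIsometryEquiv _ e e.measurePreserving⟩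
  exact h.integral_comp e.toHomeomorph.measurableEmbedding f

/-- Flipping the sign of the coordinate `s` preserves the measure and negates the integrand. -/
lemma integral_conj_mul_normalizedSphere_of_ne {s t : ι} (hst : s ≠ t) :
    ∫ x : EuclideanSpace ℂ ι, x t * conj (x s)
      ∂(volume : Measure (EuclideanSpace ℂ ι)).normalizedSphere = 0 := by
  have h := integral_normalizedSphere_comp (LinearIsometryEquiv.piLpCongrRight 2
    (fun i : ι => if i = s then LinearIsometryEquiv.neg ℝ (E := ℂ) else .refl ℝ ℂ))
    (fun x => x t * conj (x s))
  simp only [LinearIsometryEquiv.piLpCongrRight_apply, if_neg hst.symm, if_true,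
    LinearIsometryEquiv.coe_neg, LinearIsometryEquiv.coe_refl, id, map_neg, mul_neg,
    integral_neg] at h
  exact self_eq_neg.1 h.symm

/-- Swapping coordinates shows that these integrals agree for all indices, and they sum to the
integral of `‖x‖² = 1`. -/
lemma integral_mul_conj_normalizedSphere [Nonempty ι] (s : ι) :
    ∫ x : EuclideanSpace ℂ ι, x s * conj (x s)
      ∂(volume : Measure (EuclideanSpace ℂ ι)).normalizedSphere = (Fintype.card ι : ℂ)⁻¹ := by
  have hprob := isProbabilityMeasure_normalizedSphere (volume : Measure (EuclideanSpace ℂ ι))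
  have heq : ∀ t, ∫ x : EuclideanSpace ℂ ι, x t * conj (x t)
      ∂(volume : Measure (EuclideanSpace ℂ ι)).normalizedSphere =
      ∫ x : EuclideanSpace ℂ ι, x s * conj (x s)
        ∂(volume : Measure (EuclideanSpace ℂ ι)).normalizedSphere := by
    intro t
    rw [← integral_normalizedSphere_comp (LinearIsometryEquiv.piLpCongrLeft 2 ℝ ℂ
      (Equiv.swap s t))]
    simp [LinearIsometryEquiv.piLpCongrLeft_apply]
  have hsum : ∑ t, ∫ x : EuclideanSpace ℂ ι, x t * conj (x t)
      ∂(volume : Measure (EuclideanSpace ℂ ι)).normalizedSphere = 1 := by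
    rw [← integral_finsetSum _ fun t _ => Continuous.integrable_normalizedSphere _ (by fun_prop)]
    have : ∀ᵐ x ∂(volume : Measure (EuclideanSpace ℂ ι)).normalizedSphere,
        ∑ t, x t * conj (x t) = (1 : ℂ) := by
      filter_upwards [ae_normalizedSphere_norm_eq_one (volume : Measure (EuclideanSpace ℂ ι))]
        with x hx
      have h2 : ∑ t, ‖x t‖ ^ 2 = 1 := by rw [← EuclideanSpace.norm_sq_eq, hx, one_pow]
      simp_rw [Complex.mul_conj']
      exact_mod_cast h2
    rw [integral_congr_ae this]
    simp
  rw [Finset.sum_congr rfl fun t _ => heq t, Finset.sum_const, Finset.card_univ,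
    nsmul_eq_mul] at hsum
  exact (inv_eq_of_mul_eq_one_right hsum).symm

lemma continuous_inner_toEuclideanLin (A : Matrix ι ι ℂ) :
    Continuous fun x : EuclideanSpace ℂ ι => inner ℂ x (Matrix.toEuclideanLin A x) :=
  continuous_id.inner (Matrix.toEuclideanLin A).continuous_of_finiteDimensional

theorem integral_inner_toEuclideanLin_normalizedSphere [Nonempty ι] (A : Matrix ι ι ℂ) :
    ∫ x, inner ℂ x (Matrix.toEuclideanLin A x)
      ∂(volume : Measure (EuclideanSpace ℂ ι)).normalizedSphere =
      A.trace * (Fintype.card ι : ℂ)⁻¹ := by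
  have h : ∀ x : EuclideanSpace ℂ ι, inner ℂ x (Matrix.toEuclideanLin A x) =
      ∑ s, ∑ t, A s t * (x t * conj (x s)) := by
    intro x
    simp only [PiLp.inner_apply, RCLike.inner_apply, Matrix.ofLp_toLpLin, Matrix.toLin'_apply,
      Matrix.mulVec, dotProduct, Finset.sum_mul, mul_assoc]
  have hint : ∀ s t, Integrable (fun x : EuclideanSpace ℂ ι => A s t * (x t * conj (x s)))
      (volume : Measure (EuclideanSpace ℂ ι)).normalizedSphere := fun s t =>
    Continuous.integrable_normalizedSphere _ (by fun_prop)
  simp_rw [h]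
  rw [integral_finsetSum _ fun s _ => integrable_finsetSum _ fun t _ => hint s t, Matrix.trace,
    Finset.sum_mul]
  refine Finset.sum_congr rfl fun s _ => ?_
  rw [integral_finsetSum _ fun t _ => hint s t, Finset.sum_eq_single s]
  · rw [integral_const_mul, integral_mul_conj_normalizedSphere, Matrix.diag_apply]
  · intro t _ hts
    rw [integral_const_mul, integral_conj_mul_normalizedSphere_of_ne hts.symm, mul_zero]
  · simp

lemma inner_toEuclideanLin_eq_norm_sq {A : Matrix ι ι ℂ} (hA : A.IsHermitian)
    (hA2 : IsIdempotentElem A) (x : EuclideanSpace ℂ ι) :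
    inner ℂ x (Matrix.toEuclideanLin A x) = ((‖Matrix.toEuclideanLin A x‖ ^ 2 : ℝ) : ℂ) := by
  have hT : Matrix.toEuclideanLin A (Matrix.toEuclideanLin A x) = Matrix.toEuclideanLin A x := by
    conv_rhs => rw [← hA2.eq]
    rw [Matrix.toEuclideanLin, Matrix.toLpLin_mul_same]
    rfl
  rw [← hT, ← Matrix.isSymmetric_toEuclideanLin_iff.2 hA x, hT, inner_self_eq_norm_sq_to_K]
  norm_cast

/-- The trace of an idempotent is its complex rank; the factor `2` passes to real dimension, in
which the Chernoff bound is stated. -/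
lemma finrank_range_of_isIdempotentElem_toEuclideanLin {A : Matrix ι ι ℂ}
    (hA2 : IsIdempotentElem A) :
    ((Module.finrank ℝ (LinearMap.range ((Matrix.toEuclideanLin A).restrictScalars ℝ)) : ℝ) : ℂ) =
      2 * A.trace := by
  have hT : IsIdempotentElem (Matrix.toEuclideanLin A) := by
    rw [IsIdempotentElem, Module.End.mul_eq_comp, ← Matrix.toLpLin_mul_same, hA2.eq]
  have h1 := LinearMap.IsProj.trace (LinearMap.IsIdempotentElem.isProj_range _ hT)
  have h2 : Module.finrank ℝ (LinearMap.range ((Matrix.toEuclideanLin A).restrictScalars ℝ)) =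
      2 * Module.finrank ℂ (LinearMap.range (Matrix.toEuclideanLin A)) :=
    finrank_real_of_complex (LinearMap.range (Matrix.toEuclideanLin A))
  rw [Matrix.toEuclideanLin_eq_toLin_orthonormal, Matrix.trace_toLin_eq] at h1
  rw [h2, h1, Matrix.toEuclideanLin_eq_toLin_orthonormal]
  push_cast
  rfl

theorem normalizedSphere_lt_norm_inner_sub_le [Nonempty ι] {A : Matrix ι ι ℂ}
    (hA : A.IsHermitian) (hA2 : IsIdempotentElem A) {p ε : ℝ} (hε : 0 < ε)
    (hp : A.trace = p * Fintype.card ι) :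
    (volume : Measure (EuclideanSpace ℂ ι)).normalizedSphere
        {x | ε < ‖inner ℂ x (Matrix.toEuclideanLin A x) - (p : ℂ)‖} ≤
      ENNReal.ofReal (2 * Real.exp (-(1 / 2) * Fintype.card ι * ε ^ 2)) := by
  set T : EuclideanSpace ℂ ι →ₗ[ℝ] EuclideanSpace ℂ ι :=
    (Matrix.toEuclideanLin A).restrictScalars ℝ with hTdef
  have hTT : IsIdempotentElem T := by
    ext1 x
    change Matrix.toEuclideanLin A (Matrix.toEuclideanLin A x) = Matrix.toEuclideanLin A x
    conv_rhs => rw [← hA2.eq]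
    rw [Matrix.toEuclideanLin, Matrix.toLpLin_mul_same]
    rfl
  have hTx : ∀ x, inner ℂ x (Matrix.toEuclideanLin A x) = ((‖T x‖ ^ 2 : ℝ) : ℂ) :=
    inner_toEuclideanLin_eq_norm_sq hA hA2
  have hpyth : ∀ x, ‖x‖ ^ 2 = ‖T x‖ ^ 2 + ‖x - T x‖ ^ 2 := by
    intro x
    rw [norm_sub_sq (𝕜 := ℂ)]
    have : RCLike.re (inner ℂ x (T x)) = ‖T x‖ ^ 2 := by
      change RCLike.re (inner ℂ x (Matrix.toEuclideanLin A x)) = _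
      rw [hTx]
      exact Complex.ofReal_re _
    rw [this]
    ring
  have hd : Module.finrank ℝ (EuclideanSpace ℂ ι) = 2 * Fintype.card ι := by
    rw [← finrank_euclideanSpace (𝕜 := ℂ) (ι := ι)]
    exact finrank_real_of_complex _
  have hrank : (Module.finrank ℝ (LinearMap.range T) : ℝ) =
      p * Module.finrank ℝ (EuclideanSpace ℂ ι) := by
    have := finrank_range_of_isIdempotentElem_toEuclideanLin hA2
    rw [hp] at this
    rw [hd]
    have h3 : ((Module.finrank ℝ (LinearMap.range T) : ℝ) : ℂ) =
      ((2 * (p * Fintype.card ι) : ℝ) : ℂ) := by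
        rw [this]
        push_cast
        rfl
    rw [Complex.ofReal_inj.1 h3]
    push_cast
    ring
  have hTT' : IsIdempotentElem (1 - T) := hTT.one_sub
  have hpyth' : ∀ x, ‖x‖ ^ 2 = ‖(1 - T) x‖ ^ 2 + ‖x - (1 - T) x‖ ^ 2 := by
    intro x
    rw [hpyth x]
    simp [add_comm]
  have hrank' : (Module.finrank ℝ (LinearMap.range (1 - T)) : ℝ) =
      (1 - p) * Module.finrank ℝ (EuclideanSpace ℂ ι) := by
    have h4 := LinearMap.finrank_range_add_finrank_ker T
    rw [LinearMap.IsIdempotentElem.ker_eq_range_one_sub hTT] at h4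
    rw [sub_mul, ← hrank, one_mul, ← h4]
    push_cast
    ring
  have b1 := normalizedSphere_lt_norm_sq_le (volume : Measure (EuclideanSpace ℂ ι)) hTT hpyth hrank
    (lt_add_of_pos_right p hε)
  have b2 := normalizedSphere_lt_norm_sq_le (volume : Measure (EuclideanSpace ℂ ι)) hTT' hpyth'
    hrank' (lt_add_of_pos_right (1 - p) hε)
  -- The real dimension is twice the complex one, which turns the factor `1 / 4` into the final
  -- constant `1 / 2`.
  have hexp : Real.exp (-(Module.finrank ℝ (EuclideanSpace ℂ ι) * ε ^ 2 / 4)) =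
      Real.exp (-(1 / 2) * Fintype.card ι * ε ^ 2) := by
    rw [hd]
    push_cast
    ring_nf
  rw [add_sub_cancel_left, hexp] at b1 b2
  calc _ ≤ (volume : Measure (EuclideanSpace ℂ ι)).normalizedSphere
        ({x | (p + ε) * ‖x‖ ^ 2 < ‖T x‖ ^ 2} ∪ {x | (1 - p + ε) * ‖x‖ ^ 2 < ‖(1 - T) x‖ ^ 2}) := by
        -- The right-hand sets are cones, so the inclusion is claimed only for unit vectors. A lower
        -- deviation of `‖T x‖²` is an upper deviation of `‖(1 - T) x‖² = 1 - ‖T x‖²`.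
        refine measure_mono_ae ?_
        filter_upwards [ae_normalizedSphere_norm_eq_one (volume : Measure (EuclideanSpace ℂ ι))]
          with x hx hxε
        replace hxε : ε < ‖inner ℂ x (Matrix.toEuclideanLin A x) - (p : ℂ)‖ := hxε
        rw [hTx, ← Complex.ofReal_sub, Complex.norm_real, Real.norm_eq_abs] at hxε
        have h5 := hpyth x
        rw [hx] at h5
        rcases lt_abs.1 hxε with h | h
        · left
          change (p + ε) * ‖x‖ ^ 2 < ‖T x‖ ^ 2
          rw [hx]
          linarith
        · right
          change (1 - p + ε) * ‖x‖ ^ 2 < ‖x - T x‖ ^ 2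
          rw [hx]
          linarith
    _ ≤ _ := (measure_union_le _ _).trans (add_le_add b1 b2)
    _ = _ := by
        rw [← ENNReal.ofReal_add (Real.exp_pos _).le (Real.exp_pos _).le, ← two_mul]

end QuadraticForm

/-! ### Overwhelming probability and Borel–Cantelli -/

section OverwhelmingProbability

lemma exp_neg_half_le (D : ℕ) {n : ℕ} (hn : 1 ≤ n) :
    Real.exp (-(n : ℝ) / 2) ≤ D.factorial * 2 ^ D * ((n : ℝ) ^ D)⁻¹ := by
  have hn0 : (0 : ℝ) < n := by exact_mod_cast hn
  have h := Real.pow_div_factorial_le_exp ((n : ℝ) / 2) (by positivity) D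
  rw [neg_div, Real.exp_neg]
  refine (inv_anti₀ (by positivity) h).trans_eq ?_
  rw [div_pow]
  field_simp

theorem WithOverwhelmingProbability.ae_eventually_mem {Ω' : ℕ → Type}
    [∀ n, MeasurableSpace (Ω' n)] {μ : ∀ n, Measure (Ω' n)} {A : ∀ n, Set (Ω' n)}
    (h : WithOverwhelmingProbability μ A) (hA : ∀ n, MeasurableSet (A n)) {Ω : Type*}
    [MeasurableSpace Ω] {P : Measure Ω} {X : ∀ n, Ω → Ω' n}
    (hX : ∀ n, 1 ≤ n → HasLaw (X n) (μ n) P) :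
    ∀ᵐ ω ∂P, ∀ᶠ n in atTop, X n ω ∈ A n := by
  -- The exponent `2` suffices for a summable bound. The sum is shifted by one because the bound and
  -- the laws are given only for `n ≥ 1`.
  obtain ⟨K, hK⟩ := h 2
  have hs : ∑' n : ℕ, P {ω | X (n + 1) ω ∈ (A (n + 1))ᶜ} ≠ ⊤ := by
    have hsum : Summable fun n : ℕ => |K| * (((n + 1 : ℕ) : ℝ) ^ 2)⁻¹ :=
      ((summable_nat_add_iff 1).2 (Real.summable_nat_pow_inv.2 one_lt_two)).mul_left _
    refine ne_top_of_le_ne_top hsum.tsum_ofReal_ne_top (ENNReal.tsum_le_tsum fun n => ?_)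
    rw [(hX (n + 1) (by omega)).measure_eq (p := fun x => x ∈ (A (n + 1))ᶜ) (hA _).compl]
    refine (hK (n + 1) (by omega)).trans (ENNReal.ofReal_le_ofReal ?_)
    gcongr
    exact le_abs_self K
  filter_upwards [ae_eventually_notMem hs] with ω hω
  obtain ⟨N, hN⟩ := eventually_atTop.1 hω
  refine eventually_atTop.2 ⟨N + 1, fun n hn => ?_⟩
  have := hN (n - 1) (by omega)
  rw [Nat.sub_add_cancel (by omega)] at this
  exact not_not.1 this

end OverwhelmingProbability

/-! ### Overlaps with partial permutations -/

section Overlap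

variable {r : ℕ}

lemma PEquiv.one_le_domCard {β : Fin r ≃. Fin r} (hβ : β ≠ ⊥) : 1 ≤ β.domCard := by
  rw [Nat.one_le_iff_ne_zero]
  contrapose! hβ
  ext1 x
  rw [PEquiv.domCard, Finset.card_eq_zero, Finset.filter_eq_empty_iff] at hβ
  simpa using hβ (Finset.mem_univ x)

theorem integral_overlap (β : Fin r ≃. Fin r) {n : ℕ} (hn : 1 ≤ n) :
    ∫ ψ, overlap n β ψ ∂(uniformUnitVector r n) = ((n : ℂ) ^ (2 * β.domCard))⁻¹ := by
  have : NeZero n := ⟨by omega⟩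
  have hn0 : (n : ℂ) ≠ 0 := NeZero.ne _
  -- `uniformUnitVector` and `overlap` unfold definitionally to the normalized sphere measure of
  -- `volume` and to this quadratic form.
  refine (integral_inner_toEuclideanLin_normalizedSphere (partialPermMatrix n β)).trans ?_
  rw [trace_partialPermMatrix hn, Fintype.card_fun, Fintype.card_sum, Fintype.card_fin,
    Fintype.card_fin, ← two_mul, Nat.cast_pow, mul_assoc, mul_inv_cancel₀ (pow_ne_zero _ hn0),
    mul_one]

theorem uniformUnitVector_lt_norm_overlap_sub_le (β : Fin r ≃. Fin r) {n : ℕ} (hn : 1 ≤ n) {ε : ℝ}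
    (hε : 0 < ε) :
    uniformUnitVector r n {ψ | ε < ‖overlap n β ψ - ((n : ℂ) ^ (2 * β.domCard))⁻¹‖} ≤
      ENNReal.ofReal (2 * Real.exp (-(1 / 2) * (n : ℝ) ^ (2 * r) * ε ^ 2)) := by
  have : NeZero n := ⟨by omega⟩
  have hcard : Fintype.card (Fin r ⊕ Fin r → Fin n) = n ^ (2 * r) := by
    rw [Fintype.card_fun, Fintype.card_sum, Fintype.card_fin, Fintype.card_fin, ← two_mul]
  have h := normalizedSphere_lt_norm_inner_sub_le (isHermitian_partialPermMatrix n β)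
    (isIdempotentElem_partialPermMatrix hn β) (p := ((n : ℝ) ^ (2 * β.domCard))⁻¹) hε (by
      rw [trace_partialPermMatrix hn, hcard]
      push_cast
      rfl)
  rw [hcard] at h
  push_cast at h
  exact h

lemma continuous_overlap (n : ℕ) (β : Fin r ≃. Fin r) : Continuous (overlap n β) :=
  continuous_inner_toEuclideanLin _

/-- The threshold is the mean plus a deviation `n^(-1/2)`. A nonempty domain forces `r ≥ 1`, so the
exponent `n ^ (2 * r) / (2 * n)` is at least `n / 2`, while the deviation still tends to zero. -/
theorem withOverwhelmingProbability_norm_overlap_le {β : Fin r ≃. Fin r} (hβ : β ≠ ⊥) :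
    WithOverwhelmingProbability (fun n => uniformUnitVector r n) (fun n =>
      {ψ : TensorSpace r n |
        ‖overlap n β ψ‖ ≤ ((n : ℝ) ^ (2 * β.domCard))⁻¹ + (√(n : ℝ))⁻¹}) := by
  intro D
  refine ⟨2 * (D.factorial * 2 ^ D), fun n hn => ?_⟩
  have hn0 : (0 : ℝ) < n := by exact_mod_cast hn
  have hn1 : (1 : ℝ) ≤ n := by exact_mod_cast hn
  have hr : 1 ≤ r := (PEquiv.one_le_domCard hβ).trans β.domCard_le
  have hsub : {ψ : TensorSpace r n |
        ‖overlap n β ψ‖ ≤ ((n : ℝ) ^ (2 * β.domCard))⁻¹ + (√(n : ℝ))⁻¹}ᶜ ⊆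
      {ψ | (√(n : ℝ))⁻¹ < ‖overlap n β ψ - ((n : ℂ) ^ (2 * β.domCard))⁻¹‖} := by
    intro ψ hψ
    simp only [Set.mem_compl_iff, Set.mem_ofPred_eq, not_le] at hψ ⊢
    have h1 := norm_sub_norm_le (overlap n β ψ) ((n : ℂ) ^ (2 * β.domCard))⁻¹
    rw [norm_inv, norm_pow, Complex.norm_natCast] at h1
    linarith
  refine (measure_mono hsub).trans ((uniformUnitVector_lt_norm_overlap_sub_le β hn
    (by positivity)).trans (ENNReal.ofReal_le_ofReal ?_))
  rw [mul_assoc 2]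
  refine mul_le_mul_of_nonneg_left (le_trans (Real.exp_le_exp.2 ?_) (exp_neg_half_le D hn))
    zero_le_two
  rw [inv_pow, Real.sq_sqrt hn0.le]
  have h2 : (n : ℝ) ^ 2 ≤ (n : ℝ) ^ (2 * r) := pow_le_pow_right₀ hn1 (by omega)
  have h3 : (n : ℝ) ≤ (n : ℝ) ^ (2 * r) * (n : ℝ)⁻¹ := by
    rw [le_mul_inv_iff₀ hn0]
    nlinarith
  linarith

lemma tendsto_inv_pow_add_inv_sqrt {k : ℕ} (hk : 1 ≤ k) :
    Tendsto (fun n : ℕ => ((n : ℝ) ^ (2 * k))⁻¹ + (√(n : ℝ))⁻¹) atTop (𝓝 0) := by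
  have h1 : Tendsto (fun n : ℕ => ((n : ℝ) ^ (2 * k))⁻¹) atTop (𝓝 0) :=
    tendsto_inv_atTop_zero.comp ((tendsto_pow_atTop (by omega)).comp tendsto_natCast_atTop_atTop)
  have h2 : Tendsto (fun n : ℕ => (√(n : ℝ))⁻¹) atTop (𝓝 0) :=
    tendsto_inv_atTop_zero.comp (Real.tendsto_sqrt_atTop.comp tendsto_natCast_atTop_atTop)
  simpa using h1.add h2

end Overlap

theorem mainTheorem11 :
    ∃ C : ℝ, 0 < C ∧ ∀ (r : ℕ) (β : Fin r ≃. Fin r), β ≠ ⊥ →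
      (∀ n : ℕ, 1 ≤ n →
        ∫ ψ, overlap n β ψ ∂(uniformUnitVector r n) = ((n : ℂ) ^ (2 * β.domCard))⁻¹) ∧
      (∀ n : ℕ, 1 ≤ n → ∀ ε : ℝ, 0 < ε →
        uniformUnitVector r n {ψ | ε < ‖overlap n β ψ - ((n : ℂ) ^ (2 * β.domCard))⁻¹‖} ≤
          ENNReal.ofReal (2 * Real.exp (-C * (n : ℝ) ^ (2 * r) * ε ^ 2))) ∧
      (∃ ε : ℕ → ℝ, Tendsto ε atTop (𝓝 0) ∧
        WithOverwhelmingProbability (fun n => uniformUnitVector r n)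
          (fun n => {ψ : TensorSpace r n | ‖overlap n β ψ‖ ≤ ε n})) ∧
      (∀ (Ω : Type*) [MeasurableSpace Ω] (P : Measure Ω) [IsProbabilityMeasure P]
        (ψ : ∀ n : ℕ, Ω → TensorSpace r n),
        (∀ n : ℕ, 1 ≤ n → HasLaw (ψ n) (uniformUnitVector r n) P) →
        ∀ᵐ ω ∂P, Tendsto (fun n => overlap n β (ψ n ω)) atTop (𝓝 0)) := by
  refine ⟨1 / 2, by norm_num, fun r β hβ => ⟨fun n hn => integral_overlap β hn,
    fun n hn ε hε => uniformUnitVector_lt_norm_overlap_sub_le β hn hε,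
    ⟨_, tendsto_inv_pow_add_inv_sqrt (PEquiv.one_le_domCard hβ),
      withOverwhelmingProbability_norm_overlap_le hβ⟩, ?_⟩⟩
  intro Ω _ P _ ψ hψ
  filter_upwards [(withOverwhelmingProbability_norm_overlap_le hβ).ae_eventually_mem
    (fun n => (isClosed_le (continuous_overlap n β).norm continuous_const).measurableSet) hψ]
    with ω hω
  exact squeeze_zero_norm' hω (tendsto_inv_pow_add_inv_sqrt (PEquiv.one_le_domCard hβ))
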